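/- **Setting.** Fix a set of states $S$, a set $\mathcal K$ of labels of event systems, and a set of event parameters. *Syntax.* Programs are $P ::= \mathrm{Basic}\,f \mid P_1;P_2 \mid \mathrm{Cond}\,b\,P_1\,P_2 \mid \mathrm{While}\,b\,P \mid \mathrm{Await}\,b\,P \mid \mathrm{Nondt}\,r$ with $f:S\to S$, $b\subseteq S$, $r\subseteq S\times S$. An event is a basic event $\mathrm{Event}\,\alpha$, where $\alpha(p,\kappa)$ is a pair (guard $\subseteq S$, body program), or an anonymous event $\lfloor P\rfloor$, where $P$ is a program or the terminated program $\mathrm{None}$. An event system is an event set $\mathcal E_0\oplus\cdots\oplus\mathcal E_n$ or an event sequence $\mathcal E;\mathcal S$ with $\mathcal S$ an event system. A parallel event system $\mathcal{PS}$ assigns an event system to each $\kappa\in\mathcal K$. $evts(\mathcal{PS})$ is the set of all events occurring in it. *Semantics.* A configuration is $\mathcal C=(\sharp_{\mathcal C},s_{\mathcal C},x_{\mathcal C})$: a specification, a state, and an event context $x_{\mathcal C}$ assigning an event to each $\kappa$. Programs have the standard small steps, which change only program and state ($\mathrm{Await}\,b\,P$ runs $P$ to termination in one step from a state in $b$; $\mathrm{Nondt}\,r$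 moves along $r$). Transitions are labelled $t@\kappa$, where $t$ is either $c$ (a program action) or an event (its occurrence): - $\lfloor P\rfloor$ makes the steps of $P$, with label $c@\kappa$. - If $s$ is in the guard of $\alpha(p,\kappa)$ for some $p$, then $\mathrm{Event}\,\alpha$ becomes $\lfloor\text{body of }\alpha(p,\kappa)\rfloor$ with label $(\mathrm{Event}\,\alpha)@\kappa$. The state is unchanged and $x$ becomes $x(\kappa\mapsto\mathrm{Event}\,\alpha)$. - If $\mathcal E_i$ occurs and becomes $\mathcal E_i'$, then the set $\mathcal E_0\oplus\cdots\oplus\mathcal E_n$ becomes $\mathcal E_i';(\mathcal E_0\oplus\cdots\oplus\mathcal E_n)$. - If $\mathcal E$ steps to $\mathcal E'$, then $\mathcal E;\mathcal S$ steps to $\mathcal E';\mathcal S$, and also to $\mathcal S$ if $\mathcal E'=\lfloor\mathrm{None}\rfloor$. - $\mathcal{PS}$ makes a step with label $t@\kappa$ by letting $\mathcal{PS}(\kappa)$ make such a step. *Security configuration.* Let $\mathcal D$ be a set of domains with a reflexive relation $\leadsto$, a function $dom\_e:S\times\mathcal K\times\mathrm{Events}\to\mathcal D$, and an equivalence relation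 $\sim_d$ on $S$ for each $d\in\mathcal D$. Write $\mathcal C\sim_d\mathcal C'$ for $s_{\mathcal C}\sim_d s_{\mathcal C'}$. *State machine.* An action is $a=\langle\delta_a,ev_a,d_a\rangle$ (a label, an event, a domain). $(\mathcal C,\mathcal C')\in step(a)$ iff $\mathcal C\xrightarrow{\delta_a}\mathcal C'$ and either $\delta_a=ev_a@\kappa$ and $dom\_e(s_{\mathcal C},\kappa,ev_a)=d_a$, or $\delta_a=c@\kappa$, $ev_a=x_{\mathcal C}(\kappa)$ and $dom\_e(s_{\mathcal C},\kappa,ev_a)=d_a$. $\mathcal R(\mathcal C)$ means that $\mathcal C$ is reached from $\mathcal C_0=(\mathcal{PS},s_0,x_0)$ by finitely many such steps. The machine satisfies - *LR* iff for all $a,d,\mathcal C,\mathcal C'$ with $\mathcal R(\mathcal C)$, $d_a\not\leadsto d$ and $(\mathcal C,\mathcal C')\in step(a)$: $\mathcal C\sim_d\mathcal C'$; - *SC* iff for all $a,d$ and all $\mathcal C_1,\mathcal C_2$ with $\mathcal R(\mathcal C_1)$, $\mathcal R(\mathcal C_2)$, $\mathcal C_1\sim_d\mathcal C_2$ and ($d_a\leadsto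 d$ implies $\mathcal C_1\sim_{d_a}\mathcal C_2$): whenever $(\mathcal C_i,\mathcal C_i')\in step(a)$ for $i=1,2$, then $\mathcal C_1'\sim_d\mathcal C_2'$. *Rely-guarantee proof system.* A specification is $\langle pre,R,G,pst\rangle$ with $pre,pst\subseteq S$ and $R,G\subseteq S\times S$. Call $pre$ *stable* under $R$ if $s\in pre$ and $(s,s')\in R$ imply $s'\in pre$. Write $c'\Rightarrow c$ if $pre_c\subseteq pre_{c'}$, $R_c\subseteq R_{c'}$, $G_{c'}\subseteq G_c$, $pst_{c'}\subseteq pst_c$. Derivability $\vdash\sharp\ \mathbf{sat}\ c$ is generated by the following rules, of which consequence (from $c'\Rightarrow c$ and $\vdash\sharp\ \mathbf{sat}\ c'$ infer $\vdash\sharp\ \mathbf{sat}\ c$) is available for programs, events, event systems and parallel event systems. Programs, with conclusion $\langle pre,R,G,pst\rangle$: - $\mathrm{Basic}\,f$: $f(pre)\subseteq pst$; $pre,pst$ stable under $R$; $(s,f(s)),(s,s)\in G$ for $s\in pre$. - $P;Q$: $\vdash P\ \mathbf{sat}\ \langle pre,R,G,m\rangle$ and $\vdash Q\ \mathbf{sat}\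 \langle m,R,G,pst\rangle$ for some $m$. - $\mathrm{Cond}\,b\,P_1\,P_2$: $pre$ stable; $G$ reflexive; $\vdash P_1\ \mathbf{sat}\ \langle pre\cap b,R,G,pst\rangle$; $\vdash P_2\ \mathbf{sat}\ \langle pre\setminus b,R,G,pst\rangle$. - $\mathrm{While}\,b\,P$: $pre,pst$ stable; $pre\setminus b\subseteq pst$; $G$ reflexive; $\vdash P\ \mathbf{sat}\ \langle pre\cap b,R,G,pre\rangle$. - $\mathrm{Await}\,b\,P$: $pre,pst$ stable; for every $V\in S$, $\vdash P\ \mathbf{sat}\ \langle pre\cap b\cap\{V\},\mathrm{Id},S\times S,\{s\mid(V,s)\in G\}\cap pst\rangle$. - $\mathrm{Nondt}\,r$: $pre,pst$ stable; each $s\in pre$ has an $r$-successor; $s\in pre$ and $(s,s')\in r$ imply $s'\in pst$ and $(s,s')\in G$. Events: - $\vdash\lfloor P\rfloor\ \mathbf{sat}\ c$ if $\vdash P\ \mathbf{sat}\ c$. - $\vdash\mathrm{Event}\,\alpha\ \mathbf{sat}\ \langle pre,R,G,pst\rangle$ if $pre$ is stable under $R$, $G$ is reflexive and, for all $p,\kappa$,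 $\vdash(\text{body of }\alpha(p,\kappa))\ \mathbf{sat}\ \langle pre\cap(\text{guard of }\alpha(p,\kappa)),R,G,pst\rangle$. Let $\Gamma$ assign a specification to each event, with guarantee $G_{\Gamma(ev)}$. Derivability for event systems and parallel event systems is taken with respect to $\Gamma$: each event $ev$ enters the derivation with its own specification, i.e. $\vdash_\Gamma ev\ \mathbf{sat}\ c$ means $\vdash ev\ \mathbf{sat}\ \Gamma(ev)$ and $\Gamma(ev)\Rightarrow c$. - $\vdash_\Gamma\mathcal E;\mathcal S\ \mathbf{sat}\ \langle pre,R,G,pst\rangle$ if $\vdash_\Gamma\mathcal E\ \mathbf{sat}\ \langle pre,R,G,m\rangle$ and $\vdash_\Gamma\mathcal S\ \mathbf{sat}\ \langle m,R,G,pst\rangle$ for some $m$. - $\vdash_\Gamma\mathcal E_0\oplus\cdots\oplus\mathcal E_n\ \mathbf{sat}\ \langle pre,R,G,pst\rangle$ if $pre$ is stable under $R$, $G$ is reflexive, and there are $c_0,\dots,c_n$ such that, for all $i,j$, $\vdash_\Gamma\mathcal E_i\ \mathbf{sat}\ c_i$, $pre\subseteq pre_{c_i}$, $R\subseteq R_{c_i}$,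 $G_{c_i}\subseteq G$, $pst_{c_i}\subseteq pst$, $pst_{c_i}\subseteq pre_{c_j}$. - $\vdash_\Gamma\mathcal{PS}\ \mathbf{sat}\ \langle pre,R,G,pst\rangle$ if there are $c_\kappa$ ($\kappa\in\mathcal K$) such that, for all $\kappa\ne\kappa'$, $\vdash_\Gamma\mathcal{PS}(\kappa)\ \mathbf{sat}\ c_\kappa$, $pre\subseteq pre_{c_\kappa}$, $R\subseteq R_{c_\kappa}$, $G_{c_\kappa}\subseteq G$, $pst_{c_\kappa}\subseteq pst$ and $G_{c_\kappa}\subseteq R_{c_{\kappa'}}$ (all but the last also when $\mathcal K$ has only one element). *Unwinding conditions on events.* - *LRE*: for all $ev\in evts(\mathcal{PS})$, $d$, $\kappa$ and $(s,s')\in G_{\Gamma(ev)}$: if $dom\_e(s,\kappa,ev)\not\leadsto d$ then $s\sim_d s'$. - *SCE*: for all $ev\in evts(\mathcal{PS})$, $d$, $\kappa$, $s_1,s_2$ with $s_1\sim_d s_2$ and ($dom\_e(s_1,\kappa,ev)\leadsto d$ implies $s_1\sim_{dom\_e(s_1,\kappa,ev)}s_2$): whenever $(s_1,s_1'),(s_2,s_2')\in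 G_{\Gamma(ev)}$, then $s_1'\sim_d s_2'$. **Lemma (Soundness of Unwinding Conditions on Events).** Let $\mathcal{PS}$ be a parallel event system, $s_0$ a state, $x_0$ an event context, and $\Gamma$ an assignment of rely-guarantee specifications to events. Assume that 1. every $ev\in evts(\mathcal{PS})$ is a basic event; 2. $\vdash ev\ \mathbf{sat}\ \Gamma(ev)$ for every $ev\in evts(\mathcal{PS})$; 3. $\vdash_\Gamma\mathcal{PS}\ \mathbf{sat}\ \langle\{s_0\},\varnothing,S\times S,S\rangle$. Then the state machine with initial configuration $\mathcal C_0=(\mathcal{PS},s_0,x_0)$ satisfies: LRE implies LR, and SCE implies SC. -/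

import Mathlib

namespace EventRG

universe u

/-! ### Syntax -/

/-- Programs over the state space `S`. -/
inductive Prog (S : Type*) where
  | basic (f : S → S)
  | seq (P₁ P₂ : Prog S)
  | cond (b : Set S) (P₁ P₂ : Prog S)
  | while (b : Set S) (P : Prog S)
  | await (b : Set S) (P : Prog S)
  | nondt (r : Set (S × S))

/-- Events: a basic event carries an event specification `α`, which sends parameters and the label
of an event system to a guard and a body; an anonymous event wraps a program or the terminated
program `none`. -/
inductive Event (S K Prm : Type*) where
  | basic (α : Prm × K → Set S × Prog S)
  | anony (P : Option (Prog S))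

/-- `is_basic`. -/
def Event.IsBasic {S K Prm : Type*} (e : Event S K Prm) : Prop := ∃ α, e = Event.basic α

/-- Event systems: event sets `e₀ ⊕ ⋯ ⊕ eₙ` and event sequences `e ; es`. -/
inductive EvtSys (S K Prm : Type*) where
  | evtSet (n : ℕ) (e : Fin (n + 1) → Event S K Prm)
  | evtSeq (e : Event S K Prm) (es : EvtSys S K Prm)

/-- Parallel event systems. -/
abbrev ParSys (S K Prm : Type*) := K → EvtSys S K Prm

/-- The events defined in an event system. -/
def EvtSys.evts {S K Prm : Type*} : EvtSys S K Prm → Set (Event S K Prm)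
  | .evtSet _ e => Set.range e
  | .evtSeq e es => {e} ∪ es.evts

/-- The events defined in a parallel event system. -/
def ParSys.evts {S K Prm : Type*} (PS : ParSys S K Prm) : Set (Event S K Prm) :=
  ⋃ κ, (PS κ).evts

/-! ### Operational semantics -/

/-- Event contexts: the event currently executed in each event system. -/
abbrev EvtCtx (S K Prm : Type*) := K → Event S K Prm

/-- Configurations `(♯, s, x)`. -/
structure Conf (Spec S K Prm : Type*) where
  spec : Spec
  st : S
  ctx : EvtCtx S K Prm

/-- The kind of an action: a program action or the occurrence of an event. -/
inductive ActKind (S K Prm : Type*) where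
  | cmd
  | evt (e : Event S K Prm)

/-- Transition labels `t@κ`. -/
structure Label (S K Prm : Type*) where
  kind : ActKind S K Prm
  sys : K

mutual
/-- Program transitions. They neither read nor modify the event context, which is therefore
left out here and carried along by the transitions of events. -/
inductive ProgStep {S : Type u} : Option (Prog S) × S → Option (Prog S) × S → Prop
  | basic (f : S → S) (s : S) : ProgStep (some (.basic f), s) (none, f s)
  | seq1 {P₁ P₂ : Prog S} {s s' : S} (h : ProgStep (some P₁, s) (none, s')) :
      ProgStep (some (.seq P₁ P₂), s) (some P₂, s')
  | seq2 {P₁ P₁' P₂ : Prog S} {s s' : S} (h : ProgStep (some P₁, s) (some P₁', s')) :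
      ProgStep (some (.seq P₁ P₂), s) (some (.seq P₁' P₂), s')
  | condT {b : Set S} {P₁ P₂ : Prog S} {s : S} (h : s ∈ b) :
      ProgStep (some (.cond b P₁ P₂), s) (some P₁, s)
  | condF {b : Set S} {P₁ P₂ : Prog S} {s : S} (h : s ∉ b) :
      ProgStep (some (.cond b P₁ P₂), s) (some P₂, s)
  | whileF {b : Set S} {P : Prog S} {s : S} (h : s ∉ b) :
      ProgStep (some (.while b P), s) (none, s)
  | whileT {b : Set S} {P : Prog S} {s : S} (h : s ∈ b) :
      ProgStep (some (.while b P), s) (some (.seq P (.while b P)), s)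
  | await {b : Set S} {P : Prog S} {s s' : S} (hb : s ∈ b)
      (h : ProgSteps (some P, s) (none, s')) :
      ProgStep (some (.await b P), s) (none, s')
  | nondt {r : Set (S × S)} {s s' : S} (h : (s, s') ∈ r) :
      ProgStep (some (.nondt r), s) (none, s')

/-- The reflexive transitive closure of `ProgStep`. -/
inductive ProgSteps {S : Type u} : Option (Prog S) × S → Option (Prog S) × S → Prop
  | refl (c : Option (Prog S) × S) : ProgSteps c c
  | head {c₁ c₂ c₃ : Option (Prog S) × S} (h : ProgStep c₁ c₂) (h' : ProgSteps c₂ c₃) :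
      ProgSteps c₁ c₃
end

open Classical in
/-- Transitions of events. -/
inductive EvtStep {S K Prm : Type*} :
    Conf (Event S K Prm) S K Prm → Label S K Prm → Conf (Event S K Prm) S K Prm → Prop
  | anonyEvt {P P' : Option (Prog S)} {s s' : S} {x : EvtCtx S K Prm} {κ : K}
      (h : ProgStep (P, s) (P', s')) :
      EvtStep ⟨.anony P, s, x⟩ ⟨.cmd, κ⟩ ⟨.anony P', s', x⟩
  | basicEvt {α : Prm × K → Set S × Prog S} {p : Prm} {κ : K} {s : S} {x : EvtCtx S K Prm}
      (h : s ∈ (α (p, κ)).1) :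
      EvtStep ⟨.basic α, s, x⟩ ⟨.evt (.basic α), κ⟩
        ⟨.anony (some (α (p, κ)).2), s, Function.update x κ (.basic α)⟩

/-- Transitions of event systems. -/
inductive EvtSysStep {S K Prm : Type*} :
    Conf (EvtSys S K Prm) S K Prm → Label S K Prm → Conf (EvtSys S K Prm) S K Prm → Prop
  | evtSet {n : ℕ} {e : Fin (n + 1) → Event S K Prm} {i : Fin (n + 1)} {e' : Event S K Prm}
      {s : S} {x x' : EvtCtx S K Prm} {κ : K}
      (h : EvtStep ⟨e i, s, x⟩ ⟨.evt (e i), κ⟩ ⟨e', s, x'⟩) :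
      EvtSysStep ⟨.evtSet n e, s, x⟩ ⟨.evt (e i), κ⟩ ⟨.evtSeq e' (.evtSet n e), s, x'⟩
  | evtSeq1 {e e' : Event S K Prm} {es : EvtSys S K Prm} {s s' : S} {x x' : EvtCtx S K Prm}
      {l : Label S K Prm} (h : EvtStep ⟨e, s, x⟩ l ⟨e', s', x'⟩) :
      EvtSysStep ⟨.evtSeq e es, s, x⟩ l ⟨.evtSeq e' es, s', x'⟩
  | evtSeq2 {e : Event S K Prm} {es : EvtSys S K Prm} {s s' : S} {x x' : EvtCtx S K Prm}
      {l : Label S K Prm} (h : EvtStep ⟨e, s, x⟩ l ⟨.anony none, s', x'⟩) :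
      EvtSysStep ⟨.evtSeq e es, s, x⟩ l ⟨es, s', x'⟩

open Classical in
/-- Action transitions of parallel event systems. -/
inductive ParStep {S K Prm : Type*} :
    Conf (ParSys S K Prm) S K Prm → Label S K Prm → Conf (ParSys S K Prm) S K Prm → Prop
  | par {PS : ParSys S K Prm} {es' : EvtSys S K Prm} {s s' : S} {x x' : EvtCtx S K Prm}
      {t : ActKind S K Prm} {κ : K} (h : EvtSysStep ⟨PS κ, s, x⟩ ⟨t, κ⟩ ⟨es', s', x'⟩) :
      ParStep ⟨PS, s, x⟩ ⟨t, κ⟩ ⟨Function.update PS κ es', s', x'⟩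

/-! ### Information-flow configuration and the state machine -/

/-- The data of information-flow security: a reflexive policy on the domains `D`, the (state
dependent) domain of an event, and for each domain an equivalence relation on states. -/
structure IFSConfig (S K Prm D : Type*) where
  interf : D → D → Prop
  interf_refl : ∀ d, interf d d
  domE : S → K → Event S K Prm → D
  sim : D → Setoid S

/-- Actions `⟨δ, ev, d⟩`. -/
structure Action (S K Prm D : Type*) where
  label : Label S K Prm
  ev : Event S K Prm
  dom : D

/-- Nondeterministic state machines with states `Δ` and actions `A`. -/
structure StateMachine (Δ A : Type*) where
  step : A → Set (Δ × Δ)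
  init : Δ

/-- Execution of a sequence of actions, the first action of the list being executed first. -/
def StateMachine.run {Δ A : Type*} (M : StateMachine Δ A) : List A → Set (Δ × Δ)
  | [] => {p | p.1 = p.2}
  | a :: as => {p | ∃ C, (p.1, C) ∈ M.step a ∧ (C, p.2) ∈ M.run as}

/-- Reachability from the initial state of the machine. -/
def StateMachine.Reachable {Δ A : Type*} (M : StateMachine Δ A) (C : Δ) : Prop :=
  ∃ as : List A, (M.init, C) ∈ M.run as

/-- The state machine of the closed system `PS` started in state `s₀` and event context `x₀`. -/
def stateMachine {S K Prm D : Type*} (cfg : IFSConfig S K Prm D) (PS : ParSys S K Prm) (s₀ : S)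
    (x₀ : EvtCtx S K Prm) : StateMachine (Conf (ParSys S K Prm) S K Prm) (Action S K Prm D) where
  step a := {p | ParStep p.1 a.label p.2 ∧
    ((a.label.kind = .evt a.ev ∧ cfg.domE p.1.st a.label.sys a.ev = a.dom) ∨
     (a.label.kind = .cmd ∧ a.ev = p.1.ctx a.label.sys ∧
        cfg.domE p.1.st a.label.sys a.ev = a.dom))}
  init := ⟨PS, s₀, x₀⟩

/-! ### Small-step unwinding conditions -/

/-- Locally respects (LR). -/
def LocallyRespects {S K Prm D : Type*} (cfg : IFSConfig S K Prm D)
    (M : StateMachine (Conf (ParSys S K Prm) S K Prm) (Action S K Prm D)) : Prop :=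
  ∀ (a : Action S K Prm D) (d : D) (C : Conf (ParSys S K Prm) S K Prm),
    M.Reachable C → ¬ cfg.interf a.dom d → ∀ C', (C, C') ∈ M.step a → cfg.sim d C.st C'.st

/-- Step consistent (SC). -/
def StepConsistent {S K Prm D : Type*} (cfg : IFSConfig S K Prm D)
    (M : StateMachine (Conf (ParSys S K Prm) S K Prm) (Action S K Prm D)) : Prop :=
  ∀ (a : Action S K Prm D) (d : D) (C₁ C₂ : Conf (ParSys S K Prm) S K Prm),
    M.Reachable C₁ ∧ M.Reachable C₂ →
    cfg.sim d C₁.st C₂.st ∧ (cfg.interf a.dom d → cfg.sim a.dom C₁.st C₂.st) →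
    ∀ C₁' C₂', (C₁, C₁') ∈ M.step a ∧ (C₂, C₂') ∈ M.step a → cfg.sim d C₁'.st C₂'.st

/-! ### Rely-guarantee proof system -/

/-- Rely-guarantee specifications `⟨pre, R, G, pst⟩`. -/
structure RGCond (S : Type*) where
  pre : Set S
  rely : Set (S × S)
  guar : Set (S × S)
  post : Set S

/-- The side condition of the consequence rule: `c` is obtained from `c'` by strengthening the
assumptions and weakening the commitments. -/
def RGCond.Entails {S : Type*} (c' c : RGCond S) : Prop :=
  c.pre ⊆ c'.pre ∧ c.rely ⊆ c'.rely ∧ c'.guar ⊆ c.guar ∧ c'.post ⊆ c.post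

/-- `p` is preserved by all transitions in `R`. -/
def Stable {S : Type*} (p : Set S) (R : Set (S × S)) : Prop :=
  ∀ s s', s ∈ p → (s, s') ∈ R → s' ∈ p

/-- `⊢ P sat ⟨pre, R, G, pst⟩` for programs. -/
inductive ProgSat {S : Type*} : Prog S → RGCond S → Prop
  | basic {f : S → S} {pre post : Set S} {R G : Set (S × S)}
      (h₁ : pre ⊆ {s | f s ∈ post}) (h₂ : Stable pre R) (h₃ : Stable post R)
      (h₄ : {p : S × S | p.1 ∈ pre ∧ (p.2 = f p.1 ∨ p.2 = p.1)} ⊆ G) :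
      ProgSat (.basic f) ⟨pre, R, G, post⟩
  | seq {P Q : Prog S} {pre m post : Set S} {R G : Set (S × S)}
      (h₁ : ProgSat P ⟨pre, R, G, m⟩) (h₂ : ProgSat Q ⟨m, R, G, post⟩) :
      ProgSat (.seq P Q) ⟨pre, R, G, post⟩
  | cond {b : Set S} {P₁ P₂ : Prog S} {pre post : Set S} {R G : Set (S × S)}
      (h₁ : Stable pre R) (h₂ : ProgSat P₁ ⟨pre ∩ b, R, G, post⟩)
      (h₃ : ProgSat P₂ ⟨pre ∩ bᶜ, R, G, post⟩) (h₄ : ∀ s, (s, s) ∈ G) :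
      ProgSat (.cond b P₁ P₂) ⟨pre, R, G, post⟩
  | while {b : Set S} {P : Prog S} {pre post : Set S} {R G : Set (S × S)}
      (h₁ : Stable pre R) (h₂ : pre ∩ bᶜ ⊆ post) (h₃ : Stable post R)
      (h₄ : ProgSat P ⟨pre ∩ b, R, G, pre⟩) (h₅ : ∀ s, (s, s) ∈ G) :
      ProgSat (.while b P) ⟨pre, R, G, post⟩
  | await {b : Set S} {P : Prog S} {pre post : Set S} {R G : Set (S × S)}
      (h₁ : ∀ V : S, ProgSat P
        ⟨pre ∩ b ∩ {V}, {p | p.1 = p.2}, Set.univ, {s | (V, s) ∈ G} ∩ post⟩)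
      (h₂ : Stable pre R) (h₃ : Stable post R) :
      ProgSat (.await b P) ⟨pre, R, G, post⟩
  | nondt {r : Set (S × S)} {pre post : Set S} {R G : Set (S × S)}
      (h₁ : pre ⊆ {s | (∀ s', (s, s') ∈ r → s' ∈ post) ∧ ∃ s', (s, s') ∈ r})
      (h₂ : {p : S × S | p.1 ∈ pre ∧ p ∈ r} ⊆ G) (h₃ : Stable pre R) (h₄ : Stable post R) :
      ProgSat (.nondt r) ⟨pre, R, G, post⟩
  | conseq {P : Prog S} {c' c : RGCond S} (h₁ : c'.Entails c) (h₂ : ProgSat P c') : ProgSat P c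

/-- `⊢ ev sat ⟨pre, R, G, pst⟩` for events. -/
inductive EvtSat {S K Prm : Type*} : Event S K Prm → RGCond S → Prop
  | anonyEvt {P : Prog S} {c : RGCond S} (h : ProgSat P c) : EvtSat (.anony (some P)) c
  | basicEvt {α : Prm × K → Set S × Prog S} {pre post : Set S} {R G : Set (S × S)}
      (h₁ : ∀ p κ, ProgSat (α (p, κ)).2 ⟨pre ∩ (α (p, κ)).1, R, G, post⟩)
      (h₂ : Stable pre R) (h₃ : ∀ s, (s, s) ∈ G) :
      EvtSat (.basic α) ⟨pre, R, G, post⟩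
  | conseq {e : Event S K Prm} {c' c : RGCond S} (h₁ : c'.Entails c) (h₂ : EvtSat e c') :
      EvtSat e c

/-- The event `ev` together with its specification `Γ ev` is derivable, and `c` follows from
`Γ ev` by the consequence rule. -/
def EvtSatSpec {S K Prm : Type*} (Γ : Event S K Prm → RGCond S) (ev : Event S K Prm)
    (c : RGCond S) : Prop :=
  EvtSat ev (Γ ev) ∧ (Γ ev).Entails c

/-- `⊢ es sat ⟨pre, R, G, pst⟩` for event systems whose events are specified by `Γ`. -/
inductive EvtSysSat {S K Prm : Type*} (Γ : Event S K Prm → RGCond S) :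
    EvtSys S K Prm → RGCond S → Prop
  | evtSeq {e : Event S K Prm} {es : EvtSys S K Prm} {pre m post : Set S} {R G : Set (S × S)}
      (h₁ : EvtSatSpec Γ e ⟨pre, R, G, m⟩) (h₂ : EvtSysSat Γ es ⟨m, R, G, post⟩) :
      EvtSysSat Γ (.evtSeq e es) ⟨pre, R, G, post⟩
  | evtSet {n : ℕ} {e : Fin (n + 1) → Event S K Prm} {c : Fin (n + 1) → RGCond S}
      {pre post : Set S} {R G : Set (S × S)}
      (h₁ : ∀ i, EvtSatSpec Γ (e i) (c i)) (h₂ : ∀ i, pre ⊆ (c i).pre)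
      (h₃ : ∀ i, R ⊆ (c i).rely) (h₄ : ∀ i, (c i).guar ⊆ G) (h₅ : ∀ i, (c i).post ⊆ post)
      (h₆ : ∀ i j, (c i).post ⊆ (c j).pre) (h₇ : Stable pre R) (h₈ : ∀ s, (s, s) ∈ G) :
      EvtSysSat Γ (.evtSet n e) ⟨pre, R, G, post⟩
  | conseq {es : EvtSys S K Prm} {c' c : RGCond S} (h₁ : c'.Entails c)
      (h₂ : EvtSysSat Γ es c') : EvtSysSat Γ es c

/-- `⊢ PS sat ⟨pre, R, G, pst⟩` for parallel event systems whose events are specified by `Γ`. -/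
inductive ParSat {S K Prm : Type*} (Γ : Event S K Prm → RGCond S) :
    ParSys S K Prm → RGCond S → Prop
  | par {PS : ParSys S K Prm} {c : K → RGCond S} {pre post : Set S} {R G : Set (S × S)}
      (h₁ : ∀ κ, EvtSysSat Γ (PS κ) (c κ)) (h₂ : ∀ κ, pre ⊆ (c κ).pre)
      (h₃ : ∀ κ, R ⊆ (c κ).rely) (h₄ : ∀ κ, (c κ).guar ⊆ G) (h₅ : ∀ κ, (c κ).post ⊆ post)
      (h₆ : ∀ κ κ', κ ≠ κ' → (c κ).guar ⊆ (c κ').rely) :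
      ParSat Γ PS ⟨pre, R, G, post⟩
  | conseq {PS : ParSys S K Prm} {c' c : RGCond S} (h₁ : c'.Entails c)
      (h₂ : ParSat Γ PS c') : ParSat Γ PS c

/-! ### Unwinding conditions on events -/

/-- Locally respects on events (LRE). -/
def LocallyRespectsE {S K Prm D : Type*} (cfg : IFSConfig S K Prm D) (PS : ParSys S K Prm)
    (Γ : Event S K Prm → RGCond S) : Prop :=
  ∀ (ev : Event S K Prm) (d : D) (s s' : S) (κ : K),
    ev ∈ PS.evts ∧ (s, s') ∈ (Γ ev).guar → ¬ cfg.interf (cfg.domE s κ ev) d → cfg.sim d s s'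

/-- Step consistent on events (SCE). -/
def StepConsistentE {S K Prm D : Type*} (cfg : IFSConfig S K Prm D) (PS : ParSys S K Prm)
    (Γ : Event S K Prm → RGCond S) : Prop :=
  ∀ (ev : Event S K Prm) (d : D) (s₁ s₂ : S) (κ : K),
    ev ∈ PS.evts ∧ cfg.sim d s₁ s₂ →
    (cfg.interf (cfg.domE s₁ κ ev) d → cfg.sim (cfg.domE s₁ κ ev) s₁ s₂) →
    ∀ s₁' s₂', (s₁, s₁') ∈ (Γ ev).guar ∧ (s₂, s₂') ∈ (Γ ev).guar → cfg.sim d s₁' s₂'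

end EventRG

open EventRG

-- An event occurrence leaves the state unchanged, so LR and SC are immediate for it. Everything
-- therefore rests on one fact, `ParSat.step_of_reachable`: in a reachable configuration, every
-- program action of system `κ` lies in the guarantee that `Γ` gives to the event recorded in the
-- context at `κ`, and that event occurs in `PS`. LRE and SCE then apply directly to that event.
--
-- The fact is a soundness theorem for the proof system, stated with step-indexed safety predicates:
-- safety for `n + 1` steps survives any admissible environment or own step as safety for `n`. The
-- index makes loops and recurring event sets well founded. `ProgSat.safe` treats programs.
-- `EvtSysSat.safe` treats event systems, where safety also records that a system changes only its
-- own slot of the context, so the running event stays identified while other systems move. In the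
-- parallel system the inclusions of guarantees in relies turn a step of one component into an
-- environment step of all others; hence safety of every component at every index is an invariant of
-- reachability.

namespace EventRG

/-! ### Soundness of the proof system for programs -/

/-- For `n` steps of the program `P` and of its environment, the environment being constrained by
`R`, the program steps are in `G`, and `post` holds whenever `P` has terminated. -/
def ProgSafe {S : Type*} (R G : Set (S × S)) (post : Set S) : ℕ → Option (Prog S) → S → Prop
  | 0, _, _ => True
  | n + 1, P, s => (P = none → s ∈ post) ∧ (∀ s', (s, s') ∈ R → ProgSafe R G post n P s') ∧
      ∀ P' s', ProgStep (P, s) (P', s') → (s, s') ∈ G ∧ ProgSafe R G post n P' s'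

namespace ProgSafe

variable {S : Type*} {R R' G G' : Set (S × S)} {post post' : Set S}

theorem mono (hR : R' ⊆ R) (hG : G ⊆ G') (hp : post ⊆ post') :
    ∀ {n : ℕ} {P : Option (Prog S)} {s : S}, ProgSafe R G post n P s → ProgSafe R' G' post' n P s
  | 0, _, _, _ => trivial
  | _ + 1, _, _, ⟨h₁, h₂, h₃⟩ =>
    ⟨fun h => hp (h₁ h), fun s' h => mono hR hG hp (h₂ s' (hR h)),
      fun P' s' h => ⟨hG (h₃ P' s' h).1, mono hR hG hp (h₃ P' s' h).2⟩⟩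

theorem none_of_stable (hp : Stable post R) :
    ∀ {n : ℕ} {s : S}, s ∈ post → ProgSafe R G post n none s
  | 0, _, _ => trivial
  | _ + 1, s, hs =>
    ⟨fun _ => hs, fun s' h => none_of_stable hp (hp s s' hs h), fun _ _ h => nomatch h⟩

/-- A program all of whose steps from a stable precondition are covered is safe. -/
theorem of_step {P : Prog S} {pre : Set S} (hpre : Stable pre R) {N : ℕ}
    (hstep : ∀ n < N, ∀ s ∈ pre, ∀ P' s', ProgStep (some P, s) (P', s') →
      (s, s') ∈ G ∧ ProgSafe R G post n P' s') :
    ∀ n ≤ N, ∀ s ∈ pre, ProgSafe R G post n (some P) s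
  | 0, _, _, _ => trivial
  | n + 1, hn, s, hs =>
    ⟨nofun, fun s' h => of_step hpre hstep n (by omega) s' (hpre s s' hs h),
      hstep n (by omega) s hs⟩

/-- The step that terminates `P` uses up one unit of the index, so `Q` is needed only at indices
strictly below `n`. This strictness is what makes the induction for `while` go through. -/
theorem seq {Q : Prog S} {m : Set S} :
    ∀ {n : ℕ} {P : Prog S} {s : S}, ProgSafe R G m n (some P) s →
      (∀ k < n, ∀ s ∈ m, ProgSafe R G post k (some Q) s) →
      ProgSafe R G post n (some (.seq P Q)) s
  | 0, _, _, _, _ => trivial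
  | n + 1, P, s, ⟨_, h₂, h₃⟩, hQ => by
    refine ⟨nofun, fun s' h => seq (h₂ s' h) fun k hk => hQ k (by omega), ?_⟩
    intro P' s' h
    cases h with
    | seq1 h =>
      obtain ⟨hG, hs⟩ := h₃ _ _ h
      refine ⟨hG, ?_⟩
      -- Membership in `m` is recorded only at a positive index; at index zero nothing is left to
      -- prove.
      cases n with
      | zero => trivial
      | succ n => exact hQ _ (by omega) s' (hs.1 rfl)
    | seq2 h => exact ⟨(h₃ _ _ h).1, seq (h₃ _ _ h).2 fun k hk => hQ k (by omega)⟩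

/-- Used for the body of `await`. The run has no length bound known in advance, hence safety at all
indices; it is uninterrupted, so only the clause for program steps matters. -/
theorem post_of_steps {c c' : Option (Prog S) × S} (h : ProgSteps c c')
    (hc : ∀ n, ProgSafe R G post n c.1 c.2) (hn : c'.1 = none) : c'.2 ∈ post := by
  induction h using ProgSteps.rec (motive_1 := fun _ _ _ => True) with
  | refl c => exact (hc 1).1 hn
  | head h h' _ ih => exact ih (fun n => ((hc (n + 1)).2.2 _ _ h).2) hn
  | _ => trivial

end ProgSafe

theorem ProgSat.safe {S : Type*} {P : Prog S} {c : RGCond S} (h : ProgSat P c) :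
    ∀ (n : ℕ), ∀ s ∈ c.pre, ProgSafe c.rely c.guar c.post n (some P) s := by
  induction h with
  | basic h₁ h₂ h₃ h₄ =>
    refine fun n => ProgSafe.of_step h₂ (fun k _ s hs P' s' h => ?_) n le_rfl
    cases h
    exact ⟨h₄ ⟨hs, .inl rfl⟩, ProgSafe.none_of_stable h₃ (h₁ hs)⟩
  | seq _ _ ih₁ ih₂ => exact fun n s hs => ProgSafe.seq (ih₁ n s hs) fun k _ => ih₂ k
  | cond h₁ _ _ h₄ ih₁ ih₂ =>
    refine fun n => ProgSafe.of_step h₁ (fun k _ s hs P' s' h => ?_) n le_rfl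
    cases h with
    | condT h => exact ⟨h₄ s, ih₁ k s ⟨hs, h⟩⟩
    | condF h => exact ⟨h₄ s, ih₂ k s ⟨hs, h⟩⟩
  | await _ h₂ h₃ ih =>
    refine fun n => ProgSafe.of_step h₂ (fun k _ s hs P' s' h => ?_) n le_rfl
    cases h with
    | await hb h =>
      -- Taking `V := s` fixes the starting state in the postcondition, so the final state of the
      -- body yields the guarantee for the whole atomic step.
      have hpost := ProgSafe.post_of_steps h (fun n => ih s n s ⟨⟨hs, hb⟩, rfl⟩) rfl
      exact ⟨hpost.1, ProgSafe.none_of_stable h₃ hpost.2⟩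
  | nondt h₁ h₂ h₃ h₄ =>
    refine fun n => ProgSafe.of_step h₃ (fun k _ s hs P' s' h => ?_) n le_rfl
    cases h with
    | nondt h => exact ⟨h₂ ⟨hs, h⟩, ProgSafe.none_of_stable h₄ ((h₁ hs).1 _ h)⟩
  | conseq h₁ _ ih =>
    exact fun n s hs => (ih n s (h₁.1 hs)).mono h₁.2.1 h₁.2.2.1 h₁.2.2.2
  -- The `while` case: unfolding gives `seq P (while b P)` after one step, and the copy of the loop
  -- is covered by strong induction on the index.
  | _ =>
    rename_i h₁ h₂ h₃ _ h₅ ih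
    intro n
    induction n using Nat.strong_induction_on with
    | _ n ihn =>
      refine ProgSafe.of_step h₁ (fun k hk s hs P' s' h => ?_) n le_rfl
      cases h with
      | whileF h => exact ⟨h₅ s, ProgSafe.none_of_stable h₃ (h₂ ⟨hs, h⟩)⟩
      | whileT h => exact ⟨h₅ s, ProgSafe.seq (ih k s ⟨hs, h⟩) fun j hj => ihn j (by omega)⟩

/-! ### Soundness of the proof system for events and event systems -/

/-- Consequence may shrink a stable precondition to an unstable one, yet an event that has not
occurred must withstand environment steps. The precondition from the underlying `basicEvt` rule
remains stable under the final, smaller rely. -/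
theorem EvtSat.exists_pre {S K Prm : Type*} {α : Prm × K → Set S × Prog S} {c : RGCond S}
    (h : EvtSat (.basic α) c) :
    ∃ pre, c.pre ⊆ pre ∧ Stable pre c.rely ∧ (∀ s, (s, s) ∈ c.guar) ∧
      ∀ p κ, ∀ s ∈ pre ∩ (α (p, κ)).1, ∀ n,
        ProgSafe c.rely c.guar c.post n (some (α (p, κ)).2) s := by
  generalize he : Event.basic α = e at h
  induction h with
  | anonyEvt => cases he
  | basicEvt h₁ h₂ h₃ =>
    cases he
    exact ⟨_, subset_rfl, h₂, h₃, fun p κ s hs n => (h₁ p κ).safe n s hs⟩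
  | conseq h₁ _ ih =>
    obtain ⟨pre, hp, hst, hG, hb⟩ := ih he
    exact ⟨pre, h₁.1.trans hp, fun s s' hs h => hst s s' hs (h₁.2.1 h), fun s => h₁.2.2.1 (hG s),
      fun p κ s hs n => (hb p κ s hs n).mono h₁.2.1 h₁.2.2.1 h₁.2.2.2⟩

/-- For `n` steps of the event system labelled `κ` and of its environment, the environment being
constrained by `R`, the steps of the event system are in `G`, event occurrences leave the state
unchanged, and program actions are in the guarantee of the current event, which belongs to `E`. -/
def EvtSysSafe {S K Prm : Type*} (Γ : Event S K Prm → RGCond S) (E : Set (Event S K Prm)) (κ : K)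
    (R G : Set (S × S)) : ℕ → EvtSys S K Prm → S → EvtCtx S K Prm → Prop
  | 0, _, _, _ => True
  | n + 1, es, s, x =>
    (∀ s' x', (s, s') ∈ R → x' κ = x κ → EvtSysSafe Γ E κ R G n es s' x') ∧
    ∀ t es' s' x', EvtSysStep ⟨es, s, x⟩ ⟨t, κ⟩ ⟨es', s', x'⟩ →
      (s, s') ∈ G ∧ (∀ κ', κ' ≠ κ → x' κ' = x κ') ∧
      (t = .cmd → x κ ∈ E ∧ (s, s') ∈ (Γ (x κ)).guar) ∧ (t ≠ .cmd → s' = s) ∧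
      EvtSysSafe Γ E κ R G n es' s' x'

namespace EvtSysSafe

variable {S K Prm : Type*} {Γ : Event S K Prm → RGCond S} {E : Set (Event S K Prm)} {κ : K}
  {R R' G G' : Set (S × S)}

theorem mono (hR : R' ⊆ R) (hG : G ⊆ G') :
    ∀ {n : ℕ} {es : EvtSys S K Prm} {s : S} {x : EvtCtx S K Prm},
      EvtSysSafe Γ E κ R G n es s x → EvtSysSafe Γ E κ R' G' n es s x
  | 0, _, _, _, _ => trivial
  | _ + 1, _, _, _, ⟨h₁, h₂⟩ =>
    ⟨fun s' x' h hx => mono hR hG (h₁ s' x' (hR h) hx), fun t es' s' x' h =>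
      have ⟨a, b, c, d, e⟩ := h₂ t es' s' x' h
      ⟨hG a, b, c, d, mono hR hG e⟩⟩

/-- Safety of an event sequence whose first event has occurred and is being executed. -/
theorem running {es : EvtSys S K Prm} {ev : Event S K Prm} (hev : ev ∈ E)
    (hR : R ⊆ (Γ ev).rely) (hG : (Γ ev).guar ⊆ G) :
    ∀ {n : ℕ} {P : Option (Prog S)} {s : S} {x : EvtCtx S K Prm},
      ProgSafe (Γ ev).rely (Γ ev).guar (Γ ev).post n P s →
      (∀ k < n, ∀ s ∈ (Γ ev).post, ∀ x, EvtSysSafe Γ E κ R G k es s x) → x κ = ev →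
      EvtSysSafe Γ E κ R G n (.evtSeq (.anony P) es) s x
  | 0, _, _, _, _, _, _ => trivial
  | n + 1, P, s, x, ⟨_, h₂, h₃⟩, hes, hx => by
    refine ⟨fun s' x' h hx' => running hev hR hG (h₂ s' (hR h)) (fun k hk => hes k (by omega))
      (hx'.trans hx), ?_⟩
    intro t es' s' x' h
    cases h with
    | evtSeq1 h =>
      cases h with
      | anonyEvt h =>
        obtain ⟨hg, hs⟩ := h₃ _ _ h
        exact ⟨hG hg, fun _ _ => rfl, fun _ => by rw [hx]; exact ⟨hev, hg⟩, fun h => absurd rfl h,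
          running hev hR hG hs (fun k hk => hes k (by omega)) hx⟩
    | evtSeq2 h =>
      cases h with
      | anonyEvt h =>
        obtain ⟨hg, hs⟩ := h₃ _ _ h
        refine ⟨hG hg, fun _ _ => rfl, fun _ => by rw [hx]; exact ⟨hev, hg⟩,
          fun h => absurd rfl h, ?_⟩
        cases n with
        | zero => trivial
        | succ n => exact hes _ (by omega) _ (hs.1 rfl) _

end EvtSysSafe

open Classical in
theorem EvtSysSat.safe {S K Prm : Type*} {Γ : Event S K Prm → RGCond S}
    {E : Set (Event S K Prm)} (hE : ∀ ev ∈ E, ev.IsBasic) (κ : K) {es : EvtSys S K Prm}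
    {c : RGCond S} (h : EvtSysSat Γ es c) (hes : es.evts ⊆ E) :
    ∀ (n : ℕ), ∀ s ∈ c.pre, ∀ x, EvtSysSafe Γ E κ c.rely c.guar n es s x := by
  induction h with
  | @evtSeq e es pre m post R G h₁ _ ih =>
    have heE : e ∈ E := hes (.inl rfl)
    obtain ⟨α, rfl⟩ := hE e heE
    obtain ⟨hsat, hpre, hR, hG, hm⟩ := h₁
    obtain ⟨I, hI, hst, hrefl, hbody⟩ := hsat.exists_pre
    -- The waiting event is tracked by the stable set `I`, since `pre` need not be stable.
    suffices H : ∀ n, ∀ s ∈ I, ∀ x, EvtSysSafe Γ E κ R G n (.evtSeq (.basic α) es) s x from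
      fun n s hs => H n s (hI (hpre hs))
    intro n
    induction n with
    | zero => exact fun _ _ _ => trivial
    | succ n ihn =>
      refine fun s hs x => ⟨fun s' x' h _ => ihn s' (hst s s' hs (hR h)) x', ?_⟩
      intro t es' s' x' h
      cases h with
      | evtSeq1 h =>
        cases h with
        | basicEvt hg =>
          exact ⟨hG (hrefl s), fun κ' h => Function.update_of_ne h _ _, nofun,
            fun _ => rfl, EvtSysSafe.running heE hR hG (hbody _ _ s ⟨hs, hg⟩ n)
              (fun k _ s hs => ih (fun _ h => hes (.inr h)) k s (hm hs))
              (Function.update_self ..)⟩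
      -- A basic event turns into its body, never into the terminated event.
      | evtSeq2 h => cases h
  | @evtSet N e c pre post R G h₁ h₂ h₃ h₄ h₅ h₆ h₇ h₈ =>
    have heE : ∀ i, e i ∈ E := fun i => hes ⟨i, rfl⟩
    have key : ∀ i, ∃ I, (c i).pre ⊆ I ∧ Stable I R ∧ ∀ α, e i = .basic α →
        ∀ p κ, ∀ s ∈ I ∩ (α (p, κ)).1, ∀ n,
          ProgSafe (Γ (e i)).rely (Γ (e i)).guar (Γ (e i)).post n (some (α (p, κ)).2) s := by
      intro i
      obtain ⟨hsat, hpre, hR, -, -⟩ := h₁ i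
      obtain ⟨α, hα⟩ := hE _ (heE i)
      rw [hα] at hsat
      obtain ⟨I, hI, hst, -, hbody⟩ := hsat.exists_pre
      rw [← hα] at hI hst hbody
      refine ⟨I, hpre.trans hI, fun s s' hs h => hst s s' hs (hR (h₃ i h)), fun β hβ => ?_⟩
      cases hα.symm.trans hβ
      exact hbody
    choose I hI hst hbody using key
    -- Any event of the set may occur next, so all the sets `I i` must hold at once. A finished
    -- event restores them because its postcondition lies in every `(c j).pre`; the set then recurs
    -- at a smaller index.
    suffices H : ∀ n s, (∀ i, s ∈ I i) → ∀ x, EvtSysSafe Γ E κ R G n (.evtSet N e) s x from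
      fun n s hs => H n s fun i => hI i (h₂ i hs)
    intro n
    induction n using Nat.strong_induction_on with
    | _ n ihn =>
      cases n with
      | zero => exact fun _ _ _ => trivial
      | succ n =>
        refine fun s hs x =>
          ⟨fun s' x' h _ => ihn n (by omega) s' (fun i => hst i s s' (hs i) h) x', ?_⟩
        intro t es' s' x' h
        cases h with
        | @evtSet _ _ i e' _ _ _ _ h =>
          obtain ⟨α, hα⟩ := hE _ (heE i)
          have hrun := @EvtSysSafe.running S K Prm Γ E κ R G (.evtSet N e) (e i) (heE i)
            ((h₃ i).trans (h₁ i).2.2.1) ((h₁ i).2.2.2.1.trans (h₄ i)) n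
          have hnext : ∀ k < n, ∀ s ∈ (Γ (e i)).post, ∀ x,
              EvtSysSafe Γ E κ R G k (.evtSet N e) s x := fun k hk s hs =>
            ihn k (by omega) s fun j => hI j (h₆ i j ((h₁ i).2.2.2.2 hs))
          -- Case analysis on `h` needs the event to be a constructor rather than the application `e
          -- i`.
          generalize hei : e i = ev at h
          rw [hei] at hα
          subst hα
          cases h with
          | basicEvt hg =>
            refine ⟨h₈ s, fun κ' h => Function.update_of_ne h _ _, nofun,
              fun _ => rfl, hrun (hbody i α hei _ _ s ⟨hs i, hg⟩ n) hnext ?_⟩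
            rw [hei]
            exact Function.update_self ..
  | conseq h₁ _ ih =>
    exact fun n s hs x => (ih hes n s (h₁.1 hs) x).mono h₁.2.1 h₁.2.2.1

/-! ### Soundness of the proof system for parallel event systems -/

theorem ParSat.exists_specs {S K Prm : Type*} {Γ : Event S K Prm → RGCond S}
    {PS : ParSys S K Prm} {c : RGCond S} (h : ParSat Γ PS c) :
    ∃ c' : K → RGCond S, (∀ κ, EvtSysSat Γ (PS κ) (c' κ)) ∧ (∀ κ, c.pre ⊆ (c' κ).pre) ∧
      ∀ κ κ', κ ≠ κ' → (c' κ).guar ⊆ (c' κ').rely := by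
  induction h with
  | par h₁ h₂ _ _ _ h₆ => exact ⟨_, h₁, h₂, h₆⟩
  | conseq h _ ih =>
    obtain ⟨c', h₁, h₂, h₆⟩ := ih
    exact ⟨c', h₁, fun κ => h.1.trans (h₂ κ), h₆⟩

theorem StateMachine.Reachable.induction {Δ A : Type*} {M : StateMachine Δ A} {p : Δ → Prop}
    (hinit : p M.init) (hstep : ∀ a C C', p C → (C, C') ∈ M.step a → p C') {C : Δ}
    (h : M.Reachable C) : p C := by
  obtain ⟨as, h⟩ := h
  generalize M.init = C₀ at h hinit
  induction as generalizing C₀ with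
  | nil => cases (show C₀ = C from h); exact hinit
  | cons a as ih =>
    obtain ⟨C₁, h₁, h₂⟩ := h
    exact ih C₁ h₂ (hstep a C₀ C₁ hinit h₁)

open Classical in
/-- In a reachable configuration of a derivable parallel event system, event occurrences leave the
state unchanged, and program actions satisfy the guarantee of the current event. -/
theorem ParSat.step_of_reachable {S K Prm D : Type*} {cfg : IFSConfig S K Prm D}
    {PS : ParSys S K Prm} {s₀ : S} {x₀ : EvtCtx S K Prm} {Γ : Event S K Prm → RGCond S}
    (hbasic : ∀ ev ∈ PS.evts, ev.IsBasic) {c : RGCond S} (hPS : ParSat Γ PS c) (hs₀ : s₀ ∈ c.pre)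
    {C C' : Conf (ParSys S K Prm) S K Prm} (hC : (stateMachine cfg PS s₀ x₀).Reachable C)
    {t : ActKind S K Prm} {κ : K} (h : ParStep C ⟨t, κ⟩ C') :
    (t = .cmd → C.ctx κ ∈ PS.evts ∧ (C.st, C'.st) ∈ (Γ (C.ctx κ)).guar) ∧
      (t ≠ .cmd → C'.st = C.st) := by
  obtain ⟨c, h₁, h₂, h₆⟩ := hPS.exists_specs
  have hinv : ∀ κ n, EvtSysSafe Γ PS.evts κ (c κ).rely (c κ).guar n (C.spec κ) C.st C.ctx := by
    refine StateMachine.Reachable.induction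
      (p := fun C => ∀ κ n, EvtSysSafe Γ PS.evts κ (c κ).rely (c κ).guar n (C.spec κ) C.st C.ctx)
      (fun κ n => (h₁ κ).safe hbasic κ (Set.subset_iUnion (fun κ => (PS κ).evts) κ) n s₀
        (h₂ κ hs₀) x₀) ?_ hC
    rintro ⟨⟨t, κ⟩, ev, d⟩ C C' hsafe ⟨hstep, -⟩ κ' n
    cases hstep with
    | par h =>
      obtain ⟨hG, hx, -, -, hs⟩ := (hsafe κ (n + 1)).2 _ _ _ _ h
      rcases eq_or_ne κ' κ with rfl | hne
      · simpa using hs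
      -- For `κ' ≠ κ` the move is an environment step: it lies in the rely of `κ'` and keeps the
      -- context at `κ'`.
      · simpa [Function.update_of_ne hne] using
          (hsafe κ' (n + 1)).1 _ _ (h₆ κ κ' hne.symm hG) (hx κ' hne)
  cases h with
  | par h =>
    obtain ⟨-, -, hcmd, hevt, -⟩ := (hinv κ 1).2 _ _ _ _ h
    exact ⟨hcmd, hevt⟩

end EventRG

open EventRG
theorem mainTheorem5 {S K Prm D : Type*} (cfg : IFSConfig S K Prm D) (PS : ParSys S K Prm)
    (s₀ : S) (x₀ : EvtCtx S K Prm) (Γ : Event S K Prm → RGCond S)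
    (hbasic : ∀ ev ∈ PS.evts, ev.IsBasic)
    (hevts : ∀ ev ∈ PS.evts, EvtSat ev (Γ ev))
    (hPS : ParSat Γ PS ⟨{s₀}, ∅, Set.univ, Set.univ⟩) :
    (LocallyRespectsE cfg PS Γ → LocallyRespects cfg (stateMachine cfg PS s₀ x₀)) ∧
    (StepConsistentE cfg PS Γ → StepConsistent cfg (stateMachine cfg PS s₀ x₀)) := by
  refine ⟨fun hLRE => ?_, fun hSCE => ?_⟩
  · rintro ⟨⟨t, κ⟩, ev, dom⟩ d C hC hd C' ⟨hstep, hact⟩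
    obtain ⟨hcmd, hevt⟩ := hPS.step_of_reachable hbasic rfl hC hstep
    rcases hact with ⟨ht, -⟩ | ⟨ht, hev, hdom⟩
    · rw [hevt (by rintro rfl; cases ht)]
    · obtain ⟨hmem, hguar⟩ := hcmd ht
      dsimp only at hev hdom hd
      subst hev hdom
      exact hLRE _ d _ _ κ ⟨hmem, hguar⟩ hd
  · rintro ⟨⟨t, κ⟩, ev, dom⟩ d C₁ C₂ ⟨hC₁, hC₂⟩ ⟨hsim, hdsim⟩ C₁' C₂'
      ⟨⟨hstep₁, hact₁⟩, ⟨hstep₂, hact₂⟩⟩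
    obtain ⟨hcmd₁, hevt₁⟩ := hPS.step_of_reachable hbasic rfl hC₁ hstep₁
    obtain ⟨hcmd₂, hevt₂⟩ := hPS.step_of_reachable hbasic rfl hC₂ hstep₂
    rcases hact₁ with ⟨ht, -⟩ | ⟨ht, hev₁, hdom₁⟩
    · have ht' : t ≠ .cmd := by rintro rfl; cases ht
      rw [hevt₁ ht', hevt₂ ht']
      exact hsim
    -- Both steps carry the same action, so they are of the same kind and have the same current
    -- event; a single instance of SCE covers both.
    · rcases hact₂ with ⟨ht', -⟩ | ⟨-, hev₂, -⟩
      · cases ht.symm.trans ht'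
      · obtain ⟨hmem₁, hguar₁⟩ := hcmd₁ ht
        obtain ⟨-, hguar₂⟩ := hcmd₂ ht
        dsimp only at hev₁ hev₂ hdom₁ hdsim
        rw [← hev₂] at hguar₂
        rw [← hev₁] at hmem₁ hguar₁
        subst hdom₁
        exact hSCE ev d _ _ κ ⟨hmem₁, hsim⟩ hdsim _ _ ⟨hguar₁, hguar₂⟩
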